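/- Let $g\ge 0$ and let $F_{2g}=(F_g-D^2)\cup_{S^1}(F_g-D^2)$ be the closed oriented surface of genus $2g$, obtained by gluing two copies (mirror images of each other) of the closed oriented surface $F_g$ of genus $g$ with an open disk removed along their boundary circle $S^1$. Let $\sigma_1:F_{2g}\to F_{2g}$ be the reflection that fixes the gluing circle $S^1$ pointwise and interchanges the two halves, and let $f_0\in F_{2g}$ be a fixed point of $\sigma_1$. Let $S(v)$ be the unit sphere in the standard representation $v=\mathbb R^3$ of $SO(3)$, identified with the space of imaginary quaternions ($(x,y,z)\leftrightarrow xi+yj+zk$), with the action of $SU(2)\cong Sp(1)$ through $SO(3)$, i.e. $p\cdot w=pwp^{-1}$; let $e_0=(1,0,0)=i\in S(v)$. Let $F_{2g}\times_\sigma S(v)$ be the quotient of $F_{2g}\times S(v)$ by the involution $\sigma(x,w)=(\sigma_1(x),-w)$, with base point $[f_0,e_0]$ and $SU(2)$-action $p\cdot[x,w]=[x,p\cdot w]$. For $K=\mathbb C,\mathbb H$ let $G_1(K^\infty)=\varinjlim_n G_1(K^n)$ be the space of lines in the right $K$-vector space $K^\infty=\bigoplus_{\mathbb N}K$, with the direct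 limit topology. Let $SU(2)\cong Sp(1)$ act on $G_1(\mathbb H^\infty)$ by left multiplication of the coordinates and let $\mathbb Z_2$ act on $G_1(\mathbb C^\infty)=\mathbb{CP}^\infty$ by complex conjugation of the coordinates. Let $\tau:G_1(\mathbb C^\infty)\to G_1(\mathbb H^\infty)$ be the map induced by the inclusion $\mathbb C\subset\mathbb H$. Let $*\in G_1(\mathbb H^\infty)$ be a base point fixed by the subgroup $Pin(2)\subset SU(2)$ generated by the unit complex numbers and $j$. Then there is a point $*'\in G_1(\mathbb C^\infty)$, fixed by complex conjugation, with $\tau(*')=*$, and there is a canonical homeomorphism $$\Phi:\mathrm{Map}^0_{SU(2)}\bigl(F_{2g}\times_\sigma S(v),\,G_1(\mathbb H^\infty)\bigr)\;\cong\;\mathrm{Map}^0_{\mathbb Z_2}\bigl(F_{2g},\,G_1(\mathbb C^\infty)\bigr),$$ characterized by $\tau(\Phi(f)(x))=f([x,e_0])$ for all $f$ and all $x\in F_{2g}$. Here the left side is the space of continuous $SU(2)$-equivariant maps that send $[f_0,e_0]$ to $*$, the right side is the space of continuous maps $h:F_{2g}\to G_1(\mathbb C^\infty)$ with $h(\sigma_1(x))=\overline{h(x)}$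 for all $x$ and $h(f_0)=*'$, and both carry the compact-open topology. -/

import Mathlib

open scoped Quaternion LinearAlgebra.Projectivization

noncomputable section

/-! ### The surface of genus `2g` and its reflection -/

/-- Generating identifications on the boundary circle of the disk, regarded as a `4g`-gon with
sides numbered `0, …, 4g-1` whose boundary word is `∏ a_k b_k a_k⁻¹ b_k⁻¹`: for `j = 4k` (the side
`a_k`) and `j = 4k+1` (the side `b_k`), the side `j` is glued to the side `j+2` with the orientation
reversed. All vertices are identified with each other. For `g = 0` (empty word) every point of
the circle satisfies `z ^ 0 = 1`, so that the whole circle is collapsed to a point. -/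
def PolygonRel (g : ℕ) (z w : Circle) : Prop :=
  (z ^ (4 * g) = 1 ∧ w ^ (4 * g) = 1) ∨
  ∃ k < g, ∃ j : ℕ, (j = 4 * k ∨ j = 4 * k + 1) ∧ ∃ t ∈ Set.Icc (0 : ℝ) 1,
    z = Circle.exp (2 * Real.pi * (j + t) / (4 * g)) ∧
    w = Circle.exp (2 * Real.pi * (j + 3 - t) / (4 * g))

/-- On the cylinder `S¹ × [-1,1]`, identify each of the two boundary circles according to the
polygon word. -/
def CylinderRel (g : ℕ) (a b : Circle × Set.Icc (-1 : ℝ) 1) : Prop :=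
  a.2 = b.2 ∧ ((a.2 : ℝ) = 1 ∨ (a.2 : ℝ) = -1) ∧ PolygonRel g a.1 b.1

/-- The closed oriented surface `(F_g - D²) ∪_{S¹} (F_g - D²)` of genus `2g`. The part
`S¹ × [0,1]` of the cylinder with its outer circle glued along the polygon word is `F_g - D²`
(lying above the gluing circle `S¹ × {0}`), and the part `S¹ × [-1,0]` is its mirror image. -/
def DoubleSurface (g : ℕ) : Type := Quot (CylinderRel g)

instance (g : ℕ) : TopologicalSpace (DoubleSurface g) :=
  inferInstanceAs (TopologicalSpace (Quot (CylinderRel g)))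

/-- The reflection of the model surface: it fixes the gluing circle and interchanges the two
halves. -/
def DoubleSurface.reflect (g : ℕ) : DoubleSurface g → DoubleSurface g :=
  Quot.map (fun a => (a.1, ⟨-(a.2 : ℝ), by linarith [a.2.2.2], by linarith [a.2.2.1]⟩)) (by
    rintro ⟨z, s⟩ ⟨w, t⟩ ⟨h, h1, h2⟩
    obtain rfl : s = t := h
    refine ⟨rfl, ?_, h2⟩
    rcases h1 with h1 | h1
    · right; simpa using h1
    · left; simp only at h1 ⊢; rw [h1]; norm_num)

/-- `F` is a surface of genus `2g` and `σ₁` is its reflection interchanging the two halves: the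
pair `(F, σ₁)` is equivariantly homeomorphic to the model. -/
def IsReflectedSurface (g : ℕ) (F : Type*) [TopologicalSpace F] (σ₁ : F → F) : Prop :=
  ∃ e : F ≃ₜ DoubleSurface g, ∀ x, e (σ₁ x) = DoubleSurface.reflect g (e x)

/-! ### The group `SU(2) ≅ Sp(1)` and the representation sphere `S(v)` -/

/-- The quaternion `i`. -/
def quatI : ℍ[ℝ] := ⟨0, 1, 0, 0⟩

/-- The quaternion `j`. -/
def quatJ : ℍ[ℝ] := ⟨0, 0, 1, 0⟩

/-- `SU(2)`, identified with the group `Sp(1)` of unit quaternions. -/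
abbrev SU2 : Type := unitary ℍ[ℝ]

/-- The subgroup `Pin(2)` of `SU(2) ≅ Sp(1)`, generated by the standard circle of unit complex
numbers and the quaternion `j`. -/
def Pin2 : Subgroup SU2 :=
  Subgroup.closure
    ({p : SU2 | ∃ z : Circle, (p : ℍ[ℝ]) = Quaternion.ofComplex (z : ℂ)} ∪
      {p : SU2 | (p : ℍ[ℝ]) = quatJ})

/-- The unit sphere `S(v)` in the standard representation `ℝ³` of `SO(3)`, where `ℝ³` is the space
of imaginary quaternions: `(x, y, z)` corresponds to `x i + y j + z k`. -/
def SphereV : Type := {w : ℍ[ℝ] // w.re = 0 ∧ ‖w‖ = 1}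

instance : TopologicalSpace SphereV :=
  inferInstanceAs (TopologicalSpace {w : ℍ[ℝ] // w.re = 0 ∧ ‖w‖ = 1})

/-- The point `(1, 0, 0)` of `S(v)`, that is, the quaternion `i`. -/
def SphereV.e0 : SphereV := ⟨quatI, rfl, by
  have h : ‖quatI‖ * ‖quatI‖ = 1 := by
    rw [← Quaternion.normSq_eq_norm_mul_self, Quaternion.normSq_def']; simp [quatI]
  nlinarith [norm_nonneg quatI]⟩

/-- The antipodal map `σ₂` of `S(v)`. -/
def SphereV.antipode (w : SphereV) : SphereV :=
  ⟨-w.1, by simp [w.2.1], by rw [norm_neg]; exact w.2.2⟩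

/-- `SU(2)` acts on `S(v)` through the double covering `SU(2) → SO(3)`, that is, by conjugation
`p • w = p w p⁻¹` on imaginary quaternions. -/
instance : MulAction SU2 SphereV where
  smul p w := ⟨(p : ℍ[ℝ]) * w.1 * star (p : ℍ[ℝ]), by
      have hw : star w.1 = -w.1 := by
        ext <;> simp [w.2.1]
      have h : star ((p : ℍ[ℝ]) * w.1 * star (p : ℍ[ℝ])) =
          -((p : ℍ[ℝ]) * w.1 * star (p : ℍ[ℝ])) := by
        simp [hw, mul_assoc]
      have h' := congrArg QuaternionAlgebra.re h
      rw [Quaternion.re_star, Quaternion.re_neg] at h'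
      linarith, by
      have hp : ‖(p : ℍ[ℝ])‖ = 1 := CStarRing.norm_coe_unitary p
      rw [norm_mul, norm_mul, norm_star, hp, w.2.2]; norm_num⟩
  one_smul w := Subtype.ext (by
    change ((1 : SU2) : ℍ[ℝ]) * w.1 * star ((1 : SU2) : ℍ[ℝ]) = w.1
    simp)
  mul_smul p q w := Subtype.ext (by
    change ((p * q : SU2) : ℍ[ℝ]) * w.1 * star ((p * q : SU2) : ℍ[ℝ]) =
      (p : ℍ[ℝ]) * ((q : ℍ[ℝ]) * w.1 * star (q : ℍ[ℝ])) * star (p : ℍ[ℝ])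
    simp [mul_assoc])

theorem SphereV.smul_antipode (p : SU2) (w : SphereV) :
    p • w.antipode = (p • w).antipode := Subtype.ext (by
  change (p : ℍ[ℝ]) * (-w.1) * star (p : ℍ[ℝ]) = -((p : ℍ[ℝ]) * w.1 * star (p : ℍ[ℝ]))
  simp)

/-! ### The quotient `F ×_σ S(v)` -/

/-- The quotient of `F × S(v)` by the involution `σ = (σ₁, σ₂)`. -/
def TwistedProduct {F : Type*} (σ₁ : F → F) : Type _ :=
  Quot (fun a b : F × SphereV => b = (σ₁ a.1, a.2.antipode))

instance {F : Type*} [TopologicalSpace F] (σ₁ : F → F) : TopologicalSpace (TwistedProduct σ₁) :=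
  inferInstanceAs (TopologicalSpace (Quot _))

/-- The class `[x, w]`. -/
def TwistedProduct.mk {F : Type*} (σ₁ : F → F) (x : F) (w : SphereV) : TwistedProduct σ₁ :=
  Quot.mk _ (x, w)

/-- `SU(2)` acts trivially on the surface and by its action on `S(v)`: `p • [x, w] = [x, p • w]`. -/
instance {F : Type*} (σ₁ : F → F) : MulAction SU2 (TwistedProduct σ₁) where
  smul p := Quot.map (fun a => (a.1, p • a.2)) (by
    rintro a b rfl
    simp [SphereV.smul_antipode])
  one_smul a := by
    induction a using Quot.ind with
    | mk a => exact congrArg (Quot.mk _) (by simp)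
  mul_smul p q a := by
    induction a using Quot.ind with
    | mk a => exact congrArg (Quot.mk _) (by simp [mul_smul])

/-! ### The infinite Grassmannians of lines `G₁(ℂ^∞)` and `G₁(ℍ^∞)` -/

/-- `G₁(K^n)`: lines in `K^n`, viewed as a right vector space over the division ring `K`. -/
abbrev GrassOneFin (K : Type*) [DivisionRing K] (n : ℕ) : Type _ := ℙ Kᵐᵒᵖ (Fin n → K)

/-- `G₁(K^n)` is a quotient space of `K^n ∖ {0}`. -/
instance (K : Type*) [DivisionRing K] [TopologicalSpace K] (n : ℕ) :
    TopologicalSpace (GrassOneFin K n) :=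
  TopologicalSpace.coinduced (Projectivization.mk' Kᵐᵒᵖ) inferInstance

/-- `G₁(K^∞)`: lines in the right vector space `K^∞` of finitely supported sequences. -/
abbrev GrassOne (K : Type*) [DivisionRing K] : Type _ := ℙ Kᵐᵒᵖ (ℕ →₀ K)

/-- The inclusion `K^n → K^∞` as the sequences supported in the first `n` coordinates. -/
def coordInclusion (K : Type*) [DivisionRing K] (n : ℕ) : (Fin n → K) →ₗ[Kᵐᵒᵖ] (ℕ →₀ K) where
  toFun v := Finsupp.onFinset (Finset.range n) (fun i => if h : i < n then v ⟨i, h⟩ else 0) (by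
    intro i hi
    by_contra h
    exact hi (dif_neg (by simpa using h)))
  map_add' v w := by
    ext i
    by_cases h : i < n <;> simp [h]
  map_smul' a v := by
    ext i
    by_cases h : i < n <;> simp [h]

theorem coordInclusion_injective (K : Type*) [DivisionRing K] (n : ℕ) :
    Function.Injective (coordInclusion K n) := by
  intro v w h
  funext i
  have h' := DFunLike.congr_fun h (i : ℕ)
  simpa [coordInclusion] using h'

/-- `G₁(K^∞)` carries the topology of the direct limit of the spaces `G₁(K^n)`. -/
instance (K : Type*) [DivisionRing K] [TopologicalSpace K] : TopologicalSpace (GrassOne K) :=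
  ⨆ n : ℕ, TopologicalSpace.coinduced
    (Projectivization.map (coordInclusion K n) (coordInclusion_injective K n) :
      GrassOneFin K n → GrassOne K) inferInstance

/-- Applying a ring homomorphism `φ : K → L` to the coordinates:
`[x₀, x₁, …] ↦ [φ x₀, φ x₁, …]`. -/
def GrassOne.map {K L : Type*} [DivisionRing K] [DivisionRing L] (φ : K →+* L) :
    GrassOne K → GrassOne L :=
  Projectivization.map (σ := RingHom.op φ)
    { toFun := Finsupp.mapRange φ (map_zero φ)
      map_add' := fun x y => Finsupp.mapRange_add (fun a b => map_add φ a b) x y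
      map_smul' := fun a x => by ext i; simp }
    (Finsupp.mapRange_injective φ (map_zero φ) φ.injective)

/-- Complex conjugation of the coordinates on `G₁(ℂ^∞)`. -/
def GrassOne.conj : GrassOne ℂ → GrassOne ℂ := GrassOne.map (starRingEnd ℂ)

/-- The map `G₁(ℂ^∞) → G₁(ℍ^∞)` induced by the inclusion `ℂ ⊆ ℍ`. -/
def GrassOne.complexToQuaternion : GrassOne ℂ → GrassOne ℍ[ℝ] :=
  GrassOne.map (Quaternion.ofComplex : ℂ →ₐ[ℝ] ℍ[ℝ]).toRingHom

/-! ### Equivariant mapping spaces (with the compact-open topology) -/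

/-- `Map⁰_G(X, Y)`: continuous `G`-equivariant maps sending `x₀` to `y₀`. -/
abbrev EquivariantMap₀ (G : Type*) {X Y : Type*} [TopologicalSpace X] [TopologicalSpace Y]
    [SMul G X] [SMul G Y] (x₀ : X) (y₀ : Y) : Type _ :=
  {f : C(X, Y) // (∀ (p : G) (x : X), f (p • x) = p • f x) ∧ f x₀ = y₀}

/-- `Map⁰_{ℤ/2}(X, Y)`, where the generator of `ℤ/2` acts by `σ` on `X` and by `τ` on `Y`. -/
abbrev InvolutionMap₀ {X Y : Type*} [TopologicalSpace X] [TopologicalSpace Y]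
    (σ : X → X) (τ : Y → Y) (x₀ : X) (y₀ : Y) : Type _ :=
  {f : C(X, Y) // (∀ x : X, f (σ x) = τ (f x)) ∧ f x₀ = y₀}

end

/-! `SU2` acts transitively on `S(v)`, the stabilizer of `e₀ = i` is the circle of unit complex
numbers, and `j` sends `e₀` to `-e₀`. So every point of the twisted product is some `p • [x, e₀]`,
and an equivariant map is determined by its restriction to the slice `x ↦ [x, e₀]`. Its values there
are fixed by `i`, and lines fixed by `i` are exactly the extensions of complex lines
(`GrassOne.exists_complexToQuaternion_eq`). Since `j • [x, e₀] = [σ₁ x, e₀]` and `j` acts on complex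
lines by conjugation, the restriction is ℤ/2-equivariant. Conversely `p • [x, e₀] ↦ p • τ(h x)` is
well defined (`smul_eq_of_orbit_eq`).

Continuity of restriction requires τ to be an embedding
(`GrassOne.isClosedEmbedding_complexToQuaternion`), which comes from compactness of `SU2`.
Continuity of extension requires the orbit map to remain a quotient map after a product with the
mapping space (`isQuotientMap_prodMap_orbit`), and evaluation to be jointly continuous. -/

noncomputable section

/-! ### Infinite projective spaces -/

section Projective

variable {K : Type*} [DivisionRing K]

theorem coordInclusion_apply (n : ℕ) (v : Fin n → K) (i : ℕ) :
    coordInclusion K n v i = if h : i < n then v ⟨i, h⟩ else 0 := rfl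

theorem coordInclusion_ne_zero {n : ℕ} {v : Fin n → K} (hv : v ≠ 0) :
    coordInclusion K n v ≠ 0 :=
  fun h => hv (coordInclusion_injective K n (h.trans (map_zero _).symm))

theorem exists_coordInclusion_eq {n : ℕ} {w : ℕ →₀ K} (hw : ∀ i, n ≤ i → w i = 0) :
    coordInclusion K n (fun i => w i) = w := by
  ext i
  rw [coordInclusion_apply]
  split_ifs with h
  · rfl
  · exact (hw i (not_lt.1 h)).symm

theorem exists_forall_ge_eq_zero (w : ℕ →₀ K) : ∃ n, ∀ i, n ≤ i → w i = 0 := by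
  refine ⟨w.support.sup id + 1, fun i hi => ?_⟩
  by_contra h
  have := Finset.le_sup (f := id) (Finsupp.mem_support_iff.2 h)
  simp only [id] at this
  omega

theorem GrassOne.mk_eq_mk_iff {v w : ℕ →₀ K} (hv : v ≠ 0) (hw : w ≠ 0) :
    Projectivization.mk Kᵐᵒᵖ v hv = Projectivization.mk Kᵐᵒᵖ w hw ↔
      ∃ a : K, ∀ i, v i = w i * a := by
  rw [Projectivization.mk_eq_mk_iff']
  constructor
  · rintro ⟨a, rfl⟩
    exact ⟨a.unop, fun i => by simp⟩
  · rintro ⟨a, ha⟩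
    exact ⟨MulOpposite.op a, by ext i; simp [ha i]⟩

/-- The class in `G₁(K^∞)` of a nonzero vector of `K^n`. -/
def GrassOne.ofFin (n : ℕ) (v : {v : Fin n → K // v ≠ 0}) : GrassOne K :=
  Projectivization.mk Kᵐᵒᵖ (coordInclusion K n v.1) (coordInclusion_ne_zero v.2)

theorem GrassOne.exists_ofFin (b : GrassOne K) : ∃ n v, GrassOne.ofFin n v = b := by
  induction b using Projectivization.ind with
  | h w hw =>
    obtain ⟨n, hn⟩ := exists_forall_ge_eq_zero w
    have h := exists_coordInclusion_eq hn
    refine ⟨n, ⟨fun i => w i, ?_⟩, ?_⟩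
    · intro h0
      rw [h0, map_zero] at h
      exact hw h.symm
    · simp only [GrassOne.ofFin, h]

variable [TopologicalSpace K]

/-- The limit and the quotient topologies are both final, so together they are final for the maps
`GrassOne.ofFin n`. -/
theorem GrassOne.continuous_iff {Z : Type*} [TopologicalSpace Z] {f : GrassOne K → Z} :
    Continuous f ↔ ∀ n, Continuous fun v => f (GrassOne.ofFin n v) := by
  rw [continuous_iSup_dom]
  refine forall_congr' fun n => ?_
  rw [continuous_coinduced_dom]
  exact continuous_coinduced_dom

theorem GrassOne.isClosed_iff {s : Set (GrassOne K)} :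
    IsClosed s ↔ ∀ n, IsClosed (GrassOne.ofFin n ⁻¹' s) := by
  rw [isClosed_iSup_iff]
  refine forall_congr' fun n => ?_
  rw [isClosed_coinduced]
  exact isClosed_coinduced

theorem GrassOne.continuous_ofFin (n : ℕ) : Continuous (GrassOne.ofFin (K := K) n) :=
  GrassOne.continuous_iff.1 continuous_id n

theorem continuous_coordInclusion_apply (n i : ℕ) :
    Continuous fun v : Fin n → K => coordInclusion K n v i := by
  simp only [coordInclusion_apply]
  split_ifs <;> fun_prop

end Projective

/-! ### `G₁(ℂ^∞)` is Hausdorff -/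

/-- The entries of the orthogonal projection of `ℂ^∞` onto the line spanned by `v`. -/
def lineProjection (v : ℕ →₀ ℂ) (i j : ℕ) : ℂ :=
  v i * starRingEnd ℂ (v j) / (v.sum fun _ z => (‖z‖ : ℂ) ^ 2)

theorem sum_norm_sq_ne_zero {v : ℕ →₀ ℂ} (hv : v ≠ 0) :
    (v.sum fun _ z => (‖z‖ : ℂ) ^ 2) ≠ 0 := by
  have h : 0 < v.sum fun _ z => ‖z‖ ^ 2 := by
    refine Finset.sum_pos (fun i hi => ?_) (Finsupp.support_nonempty_iff.2 hv)
    have := norm_pos_iff.2 (Finsupp.mem_support_iff.1 hi)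
    positivity
  have h' : (v.sum fun _ z => (‖z‖ : ℂ) ^ 2) = ((v.sum fun _ z => ‖z‖ ^ 2 : ℝ) : ℂ) := by
    simp [Finsupp.sum]
  rw [h']
  exact_mod_cast h.ne'

/-- Numerator and denominator both scale by `a * conj a = ‖a‖ ^ 2`. -/
theorem lineProjection_eq_of_eq_mul {v w : ℕ →₀ ℂ} (hv : v ≠ 0) {a : ℂ}
    (h : ∀ i, v i = w i * a) : lineProjection v = lineProjection w := by
  have ha : a ≠ 0 := by
    rintro rfl
    exact hv (by ext i; simp [h i])
  have hs : (v.sum fun _ z => (‖z‖ : ℂ) ^ 2) =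
      (w.sum fun _ z => (‖z‖ : ℂ) ^ 2) * (‖a‖ : ℂ) ^ 2 := by
    have : v.support = w.support := by ext i; simp [h i, ha]
    simp only [Finsupp.sum, this, Finset.sum_mul]
    refine Finset.sum_congr rfl fun i _ => ?_
    rw [h i, norm_mul]
    push_cast
    ring
  funext i j
  have ha' : (‖a‖ : ℂ) ^ 2 ≠ 0 := by simpa using ha
  rw [lineProjection, hs, h i, h j, lineProjection, map_mul,
    ← mul_div_mul_right (w i * starRingEnd ℂ (w j)) _ ha']
  congr 1
  rw [← Complex.mul_conj']
  ring

/-- The orthogonal projection onto a line in `ℂ^∞`. -/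
def GrassOne.projection : GrassOne ℂ → ℕ → ℕ → ℂ :=
  Projectivization.lift (fun v => lineProjection v.1) (by
    rintro ⟨v, hv⟩ ⟨w, hw⟩ t rfl
    exact lineProjection_eq_of_eq_mul hv (a := t.unop) fun i => by simp)

/-- Any nonzero column of the projection matrix spans the line; column `j` is nonzero as soon as `v
j ≠ 0`. -/
theorem GrassOne.projection_injective : Function.Injective GrassOne.projection := by
  intro b c h
  induction b using Projectivization.ind with
  | h v hv =>
  induction c using Projectivization.ind with
  | h w hw =>
  change lineProjection v = lineProjection w at h
  obtain ⟨j, hj⟩ := Finsupp.support_nonempty_iff.2 hv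
  rw [Finsupp.mem_support_iff] at hj
  have hj' : starRingEnd ℂ (v j) ≠ 0 := by simpa using hj
  have hsv := sum_norm_sq_ne_zero hv
  refine (GrassOne.mk_eq_mk_iff hv hw).2 ⟨starRingEnd ℂ (w j) /
    (w.sum fun _ z => (‖z‖ : ℂ) ^ 2) * (v.sum fun _ z => (‖z‖ : ℂ) ^ 2) /
      starRingEnd ℂ (v j), fun i => ?_⟩
  have hi := congrFun (congrFun h i) j
  rw [lineProjection, lineProjection, div_eq_iff hsv, ← eq_div_iff hj'] at hi
  rw [hi]
  ring

theorem GrassOne.continuous_projection : Continuous GrassOne.projection := by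
  refine GrassOne.continuous_iff.2 fun n => continuous_pi fun i => continuous_pi fun j => ?_
  change Continuous fun v : {v : Fin n → ℂ // v ≠ 0} =>
    lineProjection (coordInclusion ℂ n v.1) i j
  -- The support varies with `v`; summing over the fixed range makes continuity visible.
  have hs (v : Fin n → ℂ) : ((coordInclusion ℂ n v).sum fun _ z => (‖z‖ : ℂ) ^ 2) =
      ∑ k ∈ Finset.range n, (‖coordInclusion ℂ n v k‖ : ℂ) ^ 2 :=
    Finsupp.sum_of_support_subset (coordInclusion ℂ n v)
      (fun k hk => by
        by_contra h
        exact Finsupp.mem_support_iff.1 hk (dif_neg (by simpa using h)))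
      (fun _ z => (‖z‖ : ℂ) ^ 2) (by simp)
  have hc (k : ℕ) : Continuous fun v : {v : Fin n → ℂ // v ≠ 0} => coordInclusion ℂ n v.1 k :=
    (continuous_coordInclusion_apply n k).comp continuous_subtype_val
  refine Continuous.div ((hc i).mul (Complex.continuous_conj.comp (hc j))) ?_
    fun v => sum_norm_sq_ne_zero (coordInclusion_ne_zero v.2)
  simp only [hs]
  exact continuous_finsetSum _ fun k _ => (Complex.continuous_ofReal.comp (hc k).norm).pow 2

instance : T2Space (GrassOne ℂ) :=
  .of_injective_continuous GrassOne.projection_injective GrassOne.continuous_projection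

/-! ### Unit quaternions -/

@[simp] theorem quatI_re : quatI.re = 0 := rfl
@[simp] theorem quatI_imI : quatI.imI = 1 := rfl
@[simp] theorem quatI_imJ : quatI.imJ = 0 := rfl
@[simp] theorem quatI_imK : quatI.imK = 0 := rfl
@[simp] theorem quatJ_re : quatJ.re = 0 := rfl
@[simp] theorem quatJ_imI : quatJ.imI = 0 := rfl
@[simp] theorem quatJ_imJ : quatJ.imJ = 1 := rfl
@[simp] theorem quatJ_imK : quatJ.imK = 0 := rfl

theorem quatI_mul_quatI : quatI * quatI = -1 := by
  ext <;> simp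

theorem eq_ofComplex_of_commute {x : ℍ[ℝ]} (h : quatI * x = x * quatI) :
    x = Quaternion.ofComplex ⟨x.re, x.imI⟩ := by
  have h1 := congrArg QuaternionAlgebra.imJ h
  have h2 := congrArg QuaternionAlgebra.imK h
  simp at h1 h2
  ext <;> simp <;> linarith

theorem quatJ_mul_ofComplex (z : ℂ) :
    quatJ * Quaternion.ofComplex z = Quaternion.ofComplex (starRingEnd ℂ z) * quatJ := by
  ext <;> simp

/-- The unit quaternion `q / ‖q‖`. -/
def SU2.normalize (q : ℍ[ℝ]) (hq : q ≠ 0) : SU2 :=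
  ⟨(‖q‖⁻¹ : ℝ) • q, by
    have h : (‖q‖ * ‖q‖ : ℝ) ≠ 0 := by simpa using hq
    rw [Unitary.mem_iff]
    constructor
    · rw [Quaternion.star_smul, smul_mul_smul_comm, Quaternion.star_mul_self,
        Quaternion.normSq_eq_norm_mul_self, ← mul_inv, Quaternion.smul_coe,
        inv_mul_cancel₀ h, Quaternion.coe_one]
    · rw [Quaternion.star_smul, smul_mul_smul_comm, Quaternion.self_mul_star,
        Quaternion.normSq_eq_norm_mul_self, ← mul_inv, Quaternion.smul_coe,
        inv_mul_cancel₀ h, Quaternion.coe_one]⟩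

theorem SU2.coe_normalize (q : ℍ[ℝ]) (hq : q ≠ 0) :
    (SU2.normalize q hq : ℍ[ℝ]) = (‖q‖⁻¹ : ℝ) • q := rfl

theorem exists_mul_eq_mul_quatI {q : ℍ[ℝ]} (hq : q * q = -1) :
    ∃ p : SU2, q * p = p * quatI := by
  have key : ∃ p : ℍ[ℝ], p ≠ 0 ∧ q * p = p * quatI := by
    -- The element `p = 1 - q i` satisfies `q p = q + i = p i`. It vanishes only for `q = -i`, where
    -- `j` serves instead.
    by_cases h : 1 - q * quatI = 0
    · have h' : q = -quatI := by
        have := congrArg (· * quatI) h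
        simp only [sub_mul, mul_assoc, quatI_mul_quatI] at this
        simp at this
        exact eq_neg_of_add_eq_zero_right this
      refine ⟨quatJ, fun h => by simpa [quatJ] using congrArg QuaternionAlgebra.imJ h, ?_⟩
      rw [h']
      ext <;> simp
    · refine ⟨_, h, ?_⟩
      rw [mul_sub, sub_mul, ← mul_assoc, hq, mul_assoc, quatI_mul_quatI]
      simp [add_comm]
  obtain ⟨p, hp, h⟩ := key
  exact ⟨SU2.normalize p hp, by
    rw [SU2.coe_normalize, mul_smul_comm, h, smul_mul_assoc]⟩

instance : CompactSpace SU2 := by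
  refine isCompact_iff_compactSpace.1 ?_
  have : ProperSpace ℍ[ℝ] := FiniteDimensional.proper ℝ ℍ[ℝ]
  refine Metric.isCompact_of_isClosed_isBounded isClosed_unitary ?_
  exact isBounded_iff_forall_norm_le.2
    ⟨1, fun x hx => (CStarRing.norm_coe_unitary ⟨x, hx⟩).le⟩

/-- `i` as a unit quaternion. -/
def SU2.I : SU2 := ⟨quatI, by
  rw [Unitary.mem_iff]; constructor <;> ext <;> simp⟩

/-- `j` as a unit quaternion. -/
def SU2.J : SU2 := ⟨quatJ, by
  rw [Unitary.mem_iff]; constructor <;> ext <;> simp⟩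

theorem SU2.J_mem_Pin2 : SU2.J ∈ Pin2 := Subgroup.subset_closure (Or.inr rfl)

theorem SU2.I_mem_Pin2 : SU2.I ∈ Pin2 :=
  Subgroup.subset_closure (Or.inl ⟨⟨Complex.I, by simp [Submonoid.unitSphere]⟩, by
    change quatI = _
    ext <;> simp⟩)

/-! ### The action of `SU(2)` on `G₁(ℍ^∞)` -/

theorem SU2.smul_finsupp_apply (p : SU2) (w : ℕ →₀ ℍ[ℝ]) (i : ℕ) :
    (p • w) i = (p : ℍ[ℝ]) * w i := rfl

theorem SU2.smul_coordInclusion (p : SU2) (n : ℕ) (v : Fin n → ℍ[ℝ]) :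
    p • coordInclusion ℍ[ℝ] n v = coordInclusion ℍ[ℝ] n fun i => (p : ℍ[ℝ]) * v i := by
  ext1 i
  rw [SU2.smul_finsupp_apply, coordInclusion_apply, coordInclusion_apply]
  split_ifs <;> simp

theorem SU2.smul_ofFin (p : SU2) (n : ℕ) (v : {v : Fin n → ℍ[ℝ] // v ≠ 0}) :
    ∃ h : (fun i => (p : ℍ[ℝ]) * v.1 i) ≠ 0,
      p • GrassOne.ofFin n v = GrassOne.ofFin n ⟨fun i => (p : ℍ[ℝ]) * v.1 i, h⟩ := by
  have hp : (p : ℍ[ℝ]) ≠ 0 := by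
    intro h
    have := CStarRing.norm_coe_unitary p
    rw [h, norm_zero] at this
    exact zero_ne_one this
  refine ⟨fun h => v.2 (funext fun i => ?_), ?_⟩
  · exact (mul_eq_zero.1 (congrFun h i)).resolve_left hp
  · simp only [GrassOne.ofFin, Projectivization.smul_mk, SU2.smul_coordInclusion]

theorem SU2.continuous_smul_ofFin (n : ℕ) :
    Continuous fun x : {v : Fin n → ℍ[ℝ] // v ≠ 0} × SU2 => x.2 • GrassOne.ofFin n x.1 := by
  have h : (fun x : {v : Fin n → ℍ[ℝ] // v ≠ 0} × SU2 => x.2 • GrassOne.ofFin n x.1) =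
      GrassOne.ofFin n ∘ fun x => ⟨fun i => (x.2 : ℍ[ℝ]) * x.1.1 i,
        (SU2.smul_ofFin x.2 n x.1).1⟩ :=
    funext fun x => (SU2.smul_ofFin x.2 n x.1).2
  rw [h]
  exact (GrassOne.continuous_ofFin n).comp (Continuous.subtype_mk (continuous_pi fun i =>
    (continuous_subtype_val.comp continuous_snd).mul
      ((continuous_apply i).comp (continuous_subtype_val.comp continuous_fst))) _)

/-- A product with a final topology need not be final. Currying into `C(SU2, _)` leaves a map out of
`GrassOne` alone, checked on each `GrassOne.ofFin n`; evaluation is continuous because `SU2` is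
compact Hausdorff. -/
instance : ContinuousSMul SU2 (GrassOne ℍ[ℝ]) := by
  have hc (b : GrassOne ℍ[ℝ]) : Continuous fun p : SU2 => p • b := by
    obtain ⟨n, v, rfl⟩ := b.exists_ofFin
    have h := (SU2.continuous_smul_ofFin n).comp (Continuous.prodMk_right v)
    simpa only [Function.comp_def] using h
  let k : GrassOne ℍ[ℝ] → C(SU2, GrassOne ℍ[ℝ]) := fun b => ⟨fun p => p • b, hc b⟩
  have hk : Continuous k := GrassOne.continuous_iff.2 fun n =>
    ContinuousMap.continuous_of_continuous_uncurry _ (SU2.continuous_smul_ofFin n)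
  have h : Continuous fun x : SU2 × GrassOne ℍ[ℝ] => k x.2 x.1 :=
    (hk.comp continuous_snd).eval continuous_fst
  exact ⟨h⟩

/-! ### The inclusion of `G₁(ℂ^∞)` as the fixed points of the circle -/

/-- The coordinatewise inclusion `ℂ^∞ → ℍ^∞`. -/
def ofComplexFinsupp (w : ℕ →₀ ℂ) : ℕ →₀ ℍ[ℝ] :=
  w.mapRange Quaternion.ofComplex (map_zero _)

theorem ofComplexFinsupp_apply (w : ℕ →₀ ℂ) (i : ℕ) :
    ofComplexFinsupp w i = Quaternion.ofComplex (w i) := rfl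

theorem ofComplex_injective : Function.Injective (Quaternion.ofComplex : ℂ → ℍ[ℝ]) :=
  (Quaternion.ofComplex : ℂ →ₐ[ℝ] ℍ[ℝ]).toRingHom.injective

theorem ofComplexFinsupp_ne_zero {w : ℕ →₀ ℂ} (hw : w ≠ 0) : ofComplexFinsupp w ≠ 0 := by
  intro h
  refine hw (Finsupp.ext fun i => ofComplex_injective ?_)
  exact (DFunLike.congr_fun h i).trans (map_zero _).symm

theorem GrassOne.complexToQuaternion_mk {w : ℕ →₀ ℂ} (hw : w ≠ 0) :
    GrassOne.complexToQuaternion (Projectivization.mk ℂᵐᵒᵖ w hw) =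
      Projectivization.mk ℍ[ℝ]ᵐᵒᵖ (ofComplexFinsupp w) (ofComplexFinsupp_ne_zero hw) := rfl

/-- The coordinatewise complex conjugate of a vector in `ℂ^∞`. -/
def conjFinsupp (w : ℕ →₀ ℂ) : ℕ →₀ ℂ := w.mapRange (starRingEnd ℂ) (map_zero _)

theorem conjFinsupp_apply (w : ℕ →₀ ℂ) (i : ℕ) :
    conjFinsupp w i = starRingEnd ℂ (w i) := rfl

theorem conjFinsupp_ne_zero {w : ℕ →₀ ℂ} (hw : w ≠ 0) : conjFinsupp w ≠ 0 := by
  intro h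
  refine hw (Finsupp.ext fun i => (starRingEnd ℂ).injective ?_)
  exact (DFunLike.congr_fun h i).trans (map_zero _).symm

theorem GrassOne.conj_mk {w : ℕ →₀ ℂ} (hw : w ≠ 0) :
    GrassOne.conj (Projectivization.mk ℂᵐᵒᵖ w hw) =
      Projectivization.mk ℂᵐᵒᵖ (conjFinsupp w) (conjFinsupp_ne_zero hw) := rfl

theorem GrassOne.conj_conj (c : GrassOne ℂ) : c.conj.conj = c := by
  induction c using Projectivization.ind with
  | h w hw =>
    rw [GrassOne.conj_mk, GrassOne.conj_mk]
    congr 1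
    ext i
    simp [conjFinsupp_apply]

theorem GrassOne.complexToQuaternion_injective :
    Function.Injective GrassOne.complexToQuaternion := by
  intro b c h
  induction b using Projectivization.ind with
  | h v hv =>
  induction c using Projectivization.ind with
  | h w hw =>
  rw [GrassOne.complexToQuaternion_mk, GrassOne.complexToQuaternion_mk,
    GrassOne.mk_eq_mk_iff] at h
  obtain ⟨a, ha⟩ := h
  refine (GrassOne.mk_eq_mk_iff hv hw).2 ?_
  obtain ⟨j, hj⟩ := Finsupp.support_nonempty_iff.2 hw
  rw [Finsupp.mem_support_iff] at hj
  -- The quaternionic scalar is a quotient of complex coordinates, hence complex.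
  have haj : a = Quaternion.ofComplex ((w j)⁻¹ * v j) := by
    have h := ha j
    rw [ofComplexFinsupp_apply, ofComplexFinsupp_apply] at h
    rw [map_mul, h, ← mul_assoc, ← map_mul, inv_mul_cancel₀ hj, map_one, one_mul]
  refine ⟨(w j)⁻¹ * v j, fun i => ofComplex_injective ?_⟩
  rw [map_mul, ← haj]
  exact ha i

/-- By `j z = conj z * j`, the factor `j` moves to the right, where it is a scalar. -/
theorem SU2.J_smul_complexToQuaternion (c : GrassOne ℂ) :
    SU2.J • c.complexToQuaternion = c.conj.complexToQuaternion := by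
  induction c using Projectivization.ind with
  | h w hw =>
    rw [GrassOne.conj_mk, GrassOne.complexToQuaternion_mk, GrassOne.complexToQuaternion_mk,
      Projectivization.smul_mk, GrassOne.mk_eq_mk_iff]
    exact ⟨quatJ, fun i => quatJ_mul_ofComplex (w i)⟩

/-- The centralizer of `i` is ℂ, so `p` commutes with complex coordinates and becomes a right
scalar. -/
theorem SU2.smul_complexToQuaternion_of_commute {p : SU2}
    (hp : quatI * (p : ℍ[ℝ]) = p * quatI) (c : GrassOne ℂ) :
    p • c.complexToQuaternion = c.complexToQuaternion := by
  induction c using Projectivization.ind with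
  | h w hw =>
    rw [GrassOne.complexToQuaternion_mk, Projectivization.smul_mk, GrassOne.mk_eq_mk_iff]
    refine ⟨p, fun i => ?_⟩
    rw [SU2.smul_finsupp_apply, ofComplexFinsupp_apply, eq_ofComplex_of_commute hp,
      ← map_mul, ← map_mul, mul_comm]

/-- Reduces to the commuting case, as `p j` commutes with `i`. -/
theorem SU2.smul_complexToQuaternion_of_anticommute {p : SU2}
    (hp : quatI * (p : ℍ[ℝ]) = -(p * quatI)) (c : GrassOne ℂ) :
    p • c.complexToQuaternion = c.conj.complexToQuaternion := by
  have hJ : quatI * quatJ = -(quatJ * quatI) := by ext <;> simp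
  have h : quatI * ((p * SU2.J : SU2) : ℍ[ℝ]) = (p * SU2.J : SU2) * quatI := by
    change quatI * (p * quatJ) = p * quatJ * quatI
    rw [← mul_assoc, hp, neg_mul, mul_assoc, hJ, mul_neg, neg_neg, mul_assoc]
  rw [← SU2.smul_complexToQuaternion_of_commute h c.conj, mul_smul, SU2.J_smul_complexToQuaternion,
    GrassOne.conj_conj]

/-- A line fixed by `i` is the extension of a complex line. -/
theorem GrassOne.exists_complexToQuaternion_eq {b : GrassOne ℍ[ℝ]} (hb : SU2.I • b = b) :
    ∃ c : GrassOne ℂ, c.complexToQuaternion = b := by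
  induction b using Projectivization.ind with
  | h v hv =>
  rw [Projectivization.smul_mk, GrassOne.mk_eq_mk_iff] at hb
  obtain ⟨q, hq⟩ := hb
  replace hq (i : ℕ) : quatI * v i = v i * q := hq i
  obtain ⟨k, hk⟩ := Finsupp.support_nonempty_iff.2 hv
  rw [Finsupp.mem_support_iff] at hk
  have hqq : q * q = -1 := by
    refine mul_left_cancel₀ hk ?_
    rw [← mul_assoc, ← hq, mul_assoc, ← hq, ← mul_assoc, quatI_mul_quatI]
    simp
  obtain ⟨p, hp⟩ := exists_mul_eq_mul_quatI hqq
  -- The rescaled spanning vector `v p` commutes with `i` entrywise, so its entries are complex.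
  have hvp (i : ℕ) : quatI * (v i * p) = v i * p * quatI := by
    rw [← mul_assoc, hq, mul_assoc, hp, mul_assoc]
  have hpp : (p : ℍ[ℝ]) * star (p : ℍ[ℝ]) = 1 := p.2.2
  let w : ℕ →₀ ℂ := Finsupp.onFinset v.support
    (fun i => ⟨(v i * p).re, (v i * p).imI⟩) (by
      intro i hi
      rw [Finsupp.mem_support_iff]
      intro h
      exact hi (by rw [h, zero_mul]; rfl))
  have hw (i : ℕ) : Quaternion.ofComplex (w i) = v i * p := (eq_ofComplex_of_commute (hvp i)).symm
  have hw0 : w ≠ 0 := by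
    intro h
    have := hw k
    rw [h, Finsupp.zero_apply, map_zero] at this
    refine hk ?_
    rw [← mul_one (v k), ← hpp, ← mul_assoc, ← this, zero_mul]
  refine ⟨Projectivization.mk _ w hw0, ?_⟩
  rw [GrassOne.complexToQuaternion_mk, GrassOne.mk_eq_mk_iff]
  exact ⟨p, hw⟩

/-- The coordinatewise inclusion `ℂ^n → ℍ^n`. -/
def ofComplexFin (n : ℕ) : (Fin n → ℂ) →ₗ[ℝ] (Fin n → ℍ[ℝ]) :=
  LinearMap.pi fun i =>
    (Quaternion.ofComplex : ℂ →ₐ[ℝ] ℍ[ℝ]).toLinearMap ∘ₗ LinearMap.proj i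

theorem ofComplexFin_apply (n : ℕ) (v : Fin n → ℂ) (i : Fin n) :
    ofComplexFin n v i = Quaternion.ofComplex (v i) := rfl

theorem ofComplexFin_injective (n : ℕ) : Function.Injective (ofComplexFin n) :=
  fun _ _ h => funext fun i => ofComplex_injective (congrFun h i)

theorem isClosedEmbedding_ofComplexFin (n : ℕ) :
    Topology.IsClosedEmbedding (ofComplexFin n) :=
  LinearMap.isClosedEmbedding_of_injective (LinearMap.ker_eq_bot.2 (ofComplexFin_injective n))

theorem ofComplexFinsupp_coordInclusion (n : ℕ) (v : Fin n → ℂ) :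
    ofComplexFinsupp (coordInclusion ℂ n v) = coordInclusion ℍ[ℝ] n (ofComplexFin n v) := by
  ext1 i
  rw [ofComplexFinsupp_apply, coordInclusion_apply, coordInclusion_apply]
  split_ifs
  · rfl
  · exact map_zero _

theorem ofComplexFin_ne_zero {n : ℕ} {v : Fin n → ℂ} (hv : v ≠ 0) : ofComplexFin n v ≠ 0 :=
  fun h => hv (ofComplexFin_injective n (h.trans (map_zero _).symm))

theorem GrassOne.complexToQuaternion_ofFin (n : ℕ) (v : {v : Fin n → ℂ // v ≠ 0}) :
    (GrassOne.ofFin n v).complexToQuaternion =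
      GrassOne.ofFin n ⟨ofComplexFin n v.1, ofComplexFin_ne_zero v.2⟩ := by
  simp only [GrassOne.ofFin, GrassOne.complexToQuaternion_mk, ofComplexFinsupp_coordInclusion]

theorem GrassOne.continuous_complexToQuaternion : Continuous GrassOne.complexToQuaternion := by
  refine GrassOne.continuous_iff.2 fun n => ?_
  simp only [GrassOne.complexToQuaternion_ofFin]
  exact (GrassOne.continuous_ofFin n).comp
    (((isClosedEmbedding_ofComplexFin n).continuous.comp continuous_subtype_val).subtype_mk _)

/-- A line in `ℍ^n` is the extension of a given complex line if and only if it has a complex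
spanning vector, which may be found by multiplication with a unit quaternion. -/
theorem GrassOne.ofFin_mem_image_iff {n : ℕ} (v : {v : Fin n → ℍ[ℝ] // v ≠ 0})
    (s : Set (GrassOne ℂ)) :
    GrassOne.ofFin n v ∈ GrassOne.complexToQuaternion '' s ↔
      ∃ p : SU2, ∃ e : {e : Fin n → ℂ // e ≠ 0}, GrassOne.ofFin n e ∈ s ∧
        ofComplexFin n e.1 = fun i => v.1 i * (p : ℍ[ℝ]) := by
  constructor
  · rintro ⟨c, hc, hcv⟩
    induction c using Projectivization.ind with
    | h w hw =>
    rw [GrassOne.complexToQuaternion_mk, GrassOne.ofFin, GrassOne.mk_eq_mk_iff] at hcv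
    obtain ⟨q, hq⟩ := hcv
    have hq0 : q ≠ 0 := by
      rintro rfl
      exact ofComplexFinsupp_ne_zero hw (by ext1 i; simp [hq i])
    have hwn (i : ℕ) (hi : n ≤ i) : w i = 0 := by
      refine ofComplex_injective ?_
      have := hq i
      rw [coordInclusion_apply, dif_neg (not_lt.2 hi), zero_mul] at this
      rw [map_zero]
      exact this
    -- Dividing by the real number `‖q‖` keeps the vector complex and turns the scalar `q` into a
    -- unit quaternion.
    have hcoord (i : ℕ) : coordInclusion ℂ n (fun i => w i * ((‖q‖⁻¹ : ℝ) : ℂ)) i =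
        w i * ((‖q‖⁻¹ : ℝ) : ℂ) := by
      rw [coordInclusion_apply]
      split_ifs with h
      · rfl
      · rw [hwn i (not_lt.1 h), zero_mul]
    have he : (fun i : Fin n => w i * ((‖q‖⁻¹ : ℝ) : ℂ)) ≠ 0 := by
      intro h
      refine hw (Finsupp.ext fun i => ?_)
      have := hcoord i
      rw [h, map_zero] at this
      simpa [hq0] using this.symm
    refine ⟨SU2.normalize q hq0, ⟨_, he⟩, ?_, ?_⟩
    · convert hc using 1
      rw [GrassOne.ofFin, GrassOne.mk_eq_mk_iff]
      exact ⟨_, hcoord⟩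
    · funext i
      have h := hq i
      rw [coordInclusion_apply, dif_pos i.2, ofComplexFinsupp_apply] at h
      rw [ofComplexFin_apply, SU2.coe_normalize, mul_smul_comm, ← h, ← map_smul, Complex.real_smul,
        mul_comm]
  · rintro ⟨p, e, he, h⟩
    refine ⟨_, he, ?_⟩
    rw [GrassOne.complexToQuaternion_ofFin, GrassOne.ofFin, GrassOne.ofFin,
      GrassOne.mk_eq_mk_iff]
    refine ⟨p, fun i => ?_⟩
    simp only [coordInclusion_apply, h]
    split_ifs <;> simp

theorem GrassOne.isClosedEmbedding_complexToQuaternion :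
    Topology.IsClosedEmbedding GrassOne.complexToQuaternion := by
  refine .of_continuous_injective_isClosedMap GrassOne.continuous_complexToQuaternion
    GrassOne.complexToQuaternion_injective fun s hs => GrassOne.isClosed_iff.2 fun n => ?_
  obtain ⟨E, hE, hEs⟩ := isClosed_induced_iff.1 (GrassOne.isClosed_iff.1 hs n)
  have hcl := (isClosedEmbedding_ofComplexFin n).isClosedMap E hE
  have hc : Continuous fun x : {v : Fin n → ℍ[ℝ] // v ≠ 0} × SU2 =>
      fun i => x.1.1 i * (x.2 : ℍ[ℝ]) :=
    continuous_pi fun i => ((continuous_apply i).comp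
      (continuous_subtype_val.comp continuous_fst)).mul
      (continuous_subtype_val.comp continuous_snd)
  -- The preimage of `τ(s)` in `ℍ^n ∖ {0}` is the projection along the compact group of the closed
  -- set of pairs `(v, p)` with `v p` in the image of `E`.
  convert isClosedMap_fst_of_compactSpace _ (hcl.preimage hc)
  ext v
  rw [Set.mem_preimage, GrassOne.ofFin_mem_image_iff]
  constructor
  · rintro ⟨p, e, he, h⟩
    refine ⟨(v, p), ⟨e.1, ?_, h⟩, rfl⟩
    have : e ∈ Subtype.val ⁻¹' E := hEs ▸ he
    exact this
  · rintro ⟨⟨v', p⟩, ⟨e, he, h⟩, rfl⟩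
    -- The ambient closed set `E` may contain 0, but `v p` is never 0.
    have he0 : e ≠ 0 := by
      rintro rfl
      refine v'.2 (funext fun i => ?_)
      have hi : 0 = v'.1 i * (p : ℍ[ℝ]) := by
        simpa [ofComplexFin_apply] using congrFun h i
      have hpp : (p : ℍ[ℝ]) * star (p : ℍ[ℝ]) = 1 := p.2.2
      rw [← mul_one (v'.1 i), ← hpp, ← mul_assoc, ← hi, zero_mul, Pi.zero_apply]
    refine ⟨p, ⟨e, he0⟩, ?_, h⟩
    have : (⟨e, he0⟩ : {e : Fin n → ℂ // e ≠ 0}) ∈ Subtype.val ⁻¹' E := he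
    rw [hEs] at this
    exact this

/-! ### The reflected surface -/

theorem DoubleSurface.reflect_reflect {g : ℕ} (x : DoubleSurface g) :
    DoubleSurface.reflect g (DoubleSurface.reflect g x) = x := by
  induction x using Quot.ind with
  | mk a => exact congrArg (Quot.mk _) (by ext <;> simp)

theorem DoubleSurface.continuous_reflect (g : ℕ) : Continuous (DoubleSurface.reflect g) :=
  continuous_quot_lift _ (continuous_quot_mk.comp (by fun_prop))

instance (g : ℕ) : CompactSpace (DoubleSurface g) :=
  inferInstanceAs (CompactSpace (Quot (CylinderRel g)))

namespace IsReflectedSurface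

variable {g : ℕ} {F : Type*} [TopologicalSpace F] {σ₁ : F → F}

theorem involutive (hF : IsReflectedSurface g F σ₁) : Function.Involutive σ₁ := by
  obtain ⟨e, he⟩ := hF
  intro x
  apply e.injective
  rw [he, he, DoubleSurface.reflect_reflect]

theorem continuous (hF : IsReflectedSurface g F σ₁) : Continuous σ₁ := by
  obtain ⟨e, he⟩ := hF
  rw [← e.comp_continuous_iff]
  have : e ∘ σ₁ = DoubleSurface.reflect g ∘ e := funext he
  rw [this]
  exact (DoubleSurface.continuous_reflect g).comp e.continuous

theorem compactSpace (hF : IsReflectedSurface g F σ₁) : CompactSpace F := by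
  obtain ⟨e, -⟩ := hF
  exact e.symm.compactSpace

end IsReflectedSurface

/-! ### The sphere and the twisted product -/

theorem SphereV.antipode_antipode (w : SphereV) : w.antipode.antipode = w :=
  Subtype.ext (neg_neg _)

theorem SphereV.continuous_antipode : Continuous SphereV.antipode :=
  continuous_subtype_val.neg.subtype_mk _

instance : T2Space SphereV :=
  inferInstanceAs (T2Space {w : ℍ[ℝ] // w.re = 0 ∧ ‖w‖ = 1})

/-- For `w = ±e₀` this becomes commuting or anticommuting with `i`. -/
theorem SphereV.smul_e0_eq_iff {p : SU2} {w : SphereV} :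
    p • SphereV.e0 = w ↔ w.1 * p = p * quatI := by
  have h1 : (p : ℍ[ℝ]) * star (p : ℍ[ℝ]) = 1 := p.2.2
  have h2 : star (p : ℍ[ℝ]) * (p : ℍ[ℝ]) = 1 := p.2.1
  refine Subtype.ext_iff.trans ?_
  change (p : ℍ[ℝ]) * quatI * star (p : ℍ[ℝ]) = w.1 ↔ _
  constructor
  · intro h
    rw [← h, mul_assoc, h2, mul_one]
  · intro h
    rw [← h, mul_assoc, h1, mul_one]

/-- A unit imaginary quaternion squares to -1, hence is conjugate to `i`. -/
theorem SphereV.exists_smul_e0_eq (w : SphereV) : ∃ p : SU2, p • SphereV.e0 = w := by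
  have hw : star w.1 = -w.1 := by ext <;> simp [w.2.1]
  obtain ⟨p, hp⟩ := exists_mul_eq_mul_quatI (q := w.1) (by
    have h := Quaternion.self_mul_star w.1
    rw [hw, Quaternion.normSq_eq_norm_mul_self, w.2.2, mul_neg] at h
    simpa using congrArg Neg.neg h)
  exact ⟨p, SphereV.smul_e0_eq_iff.2 hp⟩

theorem SphereV.continuous_smul_e0 : Continuous fun p : SU2 => p • SphereV.e0 :=
  Continuous.subtype_mk (f := fun p : SU2 => (p : ℍ[ℝ]) * quatI * star (p : ℍ[ℝ]))
    ((continuous_subtype_val.mul continuous_const).mul continuous_subtype_val.star) _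

theorem SphereV.J_smul_e0 : SU2.J • SphereV.e0 = SphereV.e0.antipode := by
  rw [SphereV.smul_e0_eq_iff]
  change -quatI * quatJ = quatJ * quatI
  ext <;> simp

namespace TwistedProduct

variable {F : Type*} {σ₁ : F → F}

theorem smul_mk (p : SU2) (x : F) (w : SphereV) : p • mk σ₁ x w = mk σ₁ x (p • w) := rfl

theorem mk_antipode (x : F) (w : SphereV) : mk σ₁ (σ₁ x) w.antipode = mk σ₁ x w :=
  (Quot.sound (r := fun a b : F × SphereV => b = (σ₁ a.1, a.2.antipode))
    (a := (x, w)) rfl).symm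

theorem mk_eq_mk_iff (hσ : Function.Involutive σ₁) {x y : F} {v w : SphereV} :
    mk σ₁ x v = mk σ₁ y w ↔ (y = x ∧ w = v) ∨ (y = σ₁ x ∧ w = v.antipode) := by
  constructor
  · intro h
    have h' := Quot.eqvGen_exact h
    clear h
    have key (a b : F × SphereV)
        (hab : Relation.EqvGen (fun a b : F × SphereV => b = (σ₁ a.1, a.2.antipode)) a b) :
        b = a ∨ b = (σ₁ a.1, a.2.antipode) := by
      induction hab with
      | rel a b h => exact Or.inr h
      | refl a => exact Or.inl rfl
      | symm a b _ ih =>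
        rcases ih with rfl | rfl
        · exact Or.inl rfl
        · right
          simp [hσ a.1, SphereV.antipode_antipode]
      | trans a b c _ _ ih1 ih2 =>
        rcases ih1 with rfl | rfl
        · exact ih2
        · rcases ih2 with rfl | rfl
          · exact Or.inr rfl
          · left
            simp [hσ a.1, SphereV.antipode_antipode]
    simpa using key _ _ h'
  · rintro (⟨rfl, rfl⟩ | ⟨rfl, rfl⟩)
    · rfl
    · exact (mk_antipode x v).symm

/-- The orbit map `(x, p) ↦ p • [x, e₀]`. -/
def orbit (σ₁ : F → F) (a : F × SU2) : TwistedProduct σ₁ := mk σ₁ a.1 (a.2 • SphereV.e0)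

theorem orbit_surjective : Function.Surjective (orbit σ₁) := by
  intro t
  obtain ⟨⟨x, w⟩, rfl⟩ := Quot.mk_surjective t
  obtain ⟨p, rfl⟩ := w.exists_smul_e0_eq
  exact ⟨(x, p), rfl⟩

/-- Two points of `F × SU(2)` with the same image under the orbit map have the same image under
the equivariant extension of a map `h : F → G₁(ℂ^∞)`. -/
theorem smul_eq_of_orbit_eq (hσ : Function.Involutive σ₁) {h : F → GrassOne ℂ}
    (hh : ∀ x, h (σ₁ x) = (h x).conj) {a b : F × SU2} (hab : orbit σ₁ a = orbit σ₁ b) :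
    a.2 • (h a.1).complexToQuaternion = b.2 • (h b.1).complexToQuaternion := by
  obtain ⟨x, p⟩ := a
  obtain ⟨y, q⟩ := b
  -- The element `p⁻¹ * q` sends `e₀` to `±e₀`; the sign decides whether `y` is `x` or `σ₁ x`.
  suffices (p⁻¹ * q) • (h y).complexToQuaternion = (h x).complexToQuaternion by
    change p • (h x).complexToQuaternion = q • (h y).complexToQuaternion
    rw [← this, smul_smul, mul_inv_cancel_left]
  rcases (mk_eq_mk_iff hσ).1 hab with ⟨hx, hpq⟩ | ⟨hx, hpq⟩
  · change y = x at hx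
    subst hx
    refine SU2.smul_complexToQuaternion_of_commute (SphereV.smul_e0_eq_iff (w := SphereV.e0).1 ?_) _
    change q • SphereV.e0 = p • SphereV.e0 at hpq
    rw [mul_smul, hpq, inv_smul_smul]
  · change y = σ₁ x at hx
    change q • SphereV.e0 = (p • SphereV.e0).antipode at hpq
    subst hx
    have : (p⁻¹ * q) • SphereV.e0 = SphereV.e0.antipode := by
      rw [mul_smul, hpq, SphereV.smul_antipode, inv_smul_smul]
    rw [SphereV.smul_e0_eq_iff] at this
    change -quatI * _ = _ at this
    rw [SU2.smul_complexToQuaternion_of_anticommute (by rw [← this, neg_mul, neg_neg]), hh,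
      GrassOne.conj_conj]

variable [TopologicalSpace F]

theorem continuous_mk : Continuous fun a : F × SphereV => mk σ₁ a.1 a.2 := continuous_quot_mk

/-- The saturation of `U` is `U ∪ σ⁻¹(U)`. Unlike plain quotient maps, open ones are stable under
products. -/
theorem isOpenQuotientMap_mk (hσ : Function.Involutive σ₁) (hc : Continuous σ₁) :
    IsOpenQuotientMap fun a : F × SphereV => mk σ₁ a.1 a.2 := by
  refine ⟨Quot.mk_surjective, continuous_mk, fun U hU => ?_⟩
  have hs : Continuous fun a : F × SphereV => (σ₁ a.1, a.2.antipode) :=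
    (hc.comp continuous_fst).prodMk (SphereV.continuous_antipode.comp continuous_snd)
  change IsOpen ((fun a : F × SphereV => mk σ₁ a.1 a.2) ⁻¹' _)
  convert hU.union (hU.preimage hs)
  ext ⟨y, w⟩
  simp only [Set.mem_preimage, Set.mem_image, Set.mem_union, Prod.exists, mk_eq_mk_iff hσ]
  constructor
  · rintro ⟨x, v, h, ⟨rfl, rfl⟩ | ⟨rfl, rfl⟩⟩
    · exact Or.inl h
    · right
      rwa [hσ x, SphereV.antipode_antipode]
  · rintro (h | h)
    · exact ⟨y, w, h, Or.inl ⟨rfl, rfl⟩⟩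
    · exact ⟨_, _, h, Or.inr ⟨(hσ y).symm, w.antipode_antipode.symm⟩⟩

/-- The orbit map is a proper surjection (`SU2` is compact, `S(v)` Hausdorff) followed by an open
quotient map. Both kinds survive a product with an arbitrary `A`, here the mapping space. -/
theorem isQuotientMap_prodMap_orbit (A : Type*) [TopologicalSpace A]
    (hσ : Function.Involutive σ₁) (hc : Continuous σ₁) :
    Topology.IsQuotientMap (Prod.map (id : A → A) (orbit σ₁)) := by
  have h1 : IsProperMap (Prod.map (id : A → A)
      (Prod.map (id : F → F) fun p : SU2 => p • SphereV.e0)) :=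
    isProperMap_id.prodMap (isProperMap_id.prodMap SphereV.continuous_smul_e0.isProperMap)
  have h2 : Function.Surjective (Prod.map (id : A → A)
      (Prod.map (id : F → F) fun p : SU2 => p • SphereV.e0)) :=
    Function.surjective_id.prodMap
      (Function.surjective_id.prodMap SphereV.exists_smul_e0_eq)
  exact (IsOpenQuotientMap.id.prodMap (isOpenQuotientMap_mk hσ hc)).isQuotientMap.comp
    (h1.isClosedMap.isQuotientMap h1.continuous h2)

end TwistedProduct

/-! ### Restriction to the slice and equivariant extension -/

section Restriction

variable {F : Type*} [TopologicalSpace F] {σ₁ : F → F} {f₀ : F} {c : GrassOne ℂ}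

open TwistedProduct

/-- The inclusion `x ↦ [x, e₀]`. -/
def TwistedProduct.slice (σ₁ : F → F) : C(F, TwistedProduct σ₁) :=
  ⟨fun x => mk σ₁ x SphereV.e0, continuous_mk.comp (Continuous.prodMk_left SphereV.e0)⟩

theorem EquivariantMap₀.exists_restriction
    (f : EquivariantMap₀ SU2 (mk σ₁ f₀ SphereV.e0) c.complexToQuaternion) :
    ∃ h : InvolutionMap₀ σ₁ GrassOne.conj f₀ c,
      ∀ x, (h.1 x).complexToQuaternion = f.1 (mk σ₁ x SphereV.e0) := by
  have hI : SU2.I • SphereV.e0 = SphereV.e0 := SphereV.smul_e0_eq_iff.2 rfl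
  have hex (x : F) : ∃ d : GrassOne ℂ, d.complexToQuaternion = f.1 (mk σ₁ x SphereV.e0) :=
    GrassOne.exists_complexToQuaternion_eq (by rw [← f.2.1, smul_mk, hI])
  choose h hh using hex
  have hcont : Continuous h := by
    rw [GrassOne.isClosedEmbedding_complexToQuaternion.continuous_iff]
    have : GrassOne.complexToQuaternion ∘ h = f.1 ∘ slice σ₁ := funext hh
    rw [this]
    exact f.1.continuous.comp (slice σ₁).continuous
  refine ⟨⟨⟨h, hcont⟩, fun x => ?_, ?_⟩, hh⟩
  · apply GrassOne.complexToQuaternion_injective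
    change (h (σ₁ x)).complexToQuaternion = (h x).conj.complexToQuaternion
    -- This is `j • [x, e₀] = [x, -e₀] = [σ₁ x, e₀]`.
    rw [← SU2.J_smul_complexToQuaternion, hh, hh, ← f.2.1, smul_mk, SphereV.J_smul_e0,
      ← mk_antipode x, SphereV.antipode_antipode]
  · exact GrassOne.complexToQuaternion_injective ((hh f₀).trans f.2.2)

/-- Restriction of an equivariant map to the slice `x ↦ [x, e₀]`. -/
def EquivariantMap₀.restriction
    (f : EquivariantMap₀ SU2 (mk σ₁ f₀ SphereV.e0) c.complexToQuaternion) :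
    InvolutionMap₀ σ₁ GrassOne.conj f₀ c :=
  (EquivariantMap₀.exists_restriction f).choose

theorem EquivariantMap₀.complexToQuaternion_restriction
    (f : EquivariantMap₀ SU2 (mk σ₁ f₀ SphereV.e0) c.complexToQuaternion) (x : F) :
    ((EquivariantMap₀.restriction f).1 x).complexToQuaternion = f.1 (mk σ₁ x SphereV.e0) :=
  (EquivariantMap₀.exists_restriction f).choose_spec x

/-- Postcomposition with the embedding τ induces the compact-open topology, and after it restriction
is precomposition with the slice. -/
theorem EquivariantMap₀.continuous_restriction :
    Continuous (EquivariantMap₀.restriction (σ₁ := σ₁) (f₀ := f₀) (c := c)) := by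
  let τ : C(GrassOne ℂ, GrassOne ℍ[ℝ]) :=
    ⟨GrassOne.complexToQuaternion, GrassOne.continuous_complexToQuaternion⟩
  have hτ : Topology.IsInducing τ := GrassOne.isClosedEmbedding_complexToQuaternion.isInducing
  refine continuous_induced_rng.2 ((ContinuousMap.isInducing_postcomp τ hτ).continuous_iff.2 ?_)
  refine ((ContinuousMap.continuous_precomp (slice σ₁)).comp continuous_subtype_val).congr
    fun f => ?_
  exact ContinuousMap.ext fun x => (EquivariantMap₀.complexToQuaternion_restriction f x).symm

/-- The value at `[x, p • e₀]` of the equivariant extension of `h` is `p • τ(h(x))`. -/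
def InvolutionMap₀.extensionFun (h : InvolutionMap₀ σ₁ GrassOne.conj f₀ c)
    (t : TwistedProduct σ₁) : GrassOne ℍ[ℝ] :=
  (Function.surjInv orbit_surjective t).2 •
    (h.1 (Function.surjInv orbit_surjective t).1).complexToQuaternion

/-- Independence of the preimage picked by `Function.surjInv`. -/
theorem InvolutionMap₀.extensionFun_orbit (hσ : Function.Involutive σ₁)
    (h : InvolutionMap₀ σ₁ GrassOne.conj f₀ c) (a : F × SU2) :
    InvolutionMap₀.extensionFun h (orbit σ₁ a) = a.2 • (h.1 a.1).complexToQuaternion :=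
  smul_eq_of_orbit_eq hσ h.2.1 (Function.surjInv_eq orbit_surjective _)

theorem InvolutionMap₀.extensionFun_mk (hσ : Function.Involutive σ₁)
    (h : InvolutionMap₀ σ₁ GrassOne.conj f₀ c) (x : F) :
    InvolutionMap₀.extensionFun h (mk σ₁ x SphereV.e0) = (h.1 x).complexToQuaternion := by
  have := InvolutionMap₀.extensionFun_orbit hσ h (x, 1)
  rwa [orbit, one_smul, one_smul] at this

theorem InvolutionMap₀.extensionFun_smul (hσ : Function.Involutive σ₁)
    (h : InvolutionMap₀ σ₁ GrassOne.conj f₀ c) (p : SU2) (t : TwistedProduct σ₁) :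
    InvolutionMap₀.extensionFun h (p • t) = p • InvolutionMap₀.extensionFun h t := by
  obtain ⟨⟨x, q⟩, rfl⟩ := orbit_surjective t
  have : p • orbit σ₁ (x, q) = orbit σ₁ (x, p * q) := by
    rw [orbit, orbit, smul_mk, mul_smul]
  rw [this, InvolutionMap₀.extensionFun_orbit hσ, InvolutionMap₀.extensionFun_orbit hσ, mul_smul]

/-- Joint continuity gives both the continuity of each extension and, by currying, continuous
dependence on `h`. -/
theorem InvolutionMap₀.continuous_uncurry_extensionFun [CompactSpace F]
    (hσ : Function.Involutive σ₁) (hc : Continuous σ₁) :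
    Continuous fun a : InvolutionMap₀ σ₁ GrassOne.conj f₀ c × TwistedProduct σ₁ =>
      InvolutionMap₀.extensionFun a.1 a.2 := by
  rw [(isQuotientMap_prodMap_orbit _ hσ hc).continuous_iff]
  have : (fun a : InvolutionMap₀ σ₁ GrassOne.conj f₀ c × TwistedProduct σ₁ =>
      InvolutionMap₀.extensionFun a.1 a.2) ∘ Prod.map id (orbit σ₁) =
        fun a => a.2.2 • (a.1.1 a.2.1).complexToQuaternion :=
    funext fun a => InvolutionMap₀.extensionFun_orbit hσ a.1 a.2
  rw [this]
  -- Evaluation is continuous because `F` is compact and the target `G₁(ℂ^∞)` is Hausdorff.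
  have hev : Continuous fun a : InvolutionMap₀ σ₁ GrassOne.conj f₀ c × F × SU2 => a.1.1 a.2.1 :=
    (continuous_subtype_val.comp continuous_fst).eval (continuous_fst.comp continuous_snd)
  exact (continuous_snd.comp continuous_snd).smul
    (GrassOne.continuous_complexToQuaternion.comp hev)

theorem InvolutionMap₀.continuous_extensionFun [CompactSpace F]
    (hσ : Function.Involutive σ₁) (hc : Continuous σ₁)
    (h : InvolutionMap₀ σ₁ GrassOne.conj f₀ c) :
    Continuous (InvolutionMap₀.extensionFun h) := by
  have h' := (InvolutionMap₀.continuous_uncurry_extensionFun (f₀ := f₀) (c := c) hσ hc).comp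
    (Continuous.prodMk_right h)
  simpa only [Function.comp_def] using h'

/-- The equivariant extension `[x, p • e₀] ↦ p • τ(h(x))`. -/
def InvolutionMap₀.extension [CompactSpace F] (hσ : Function.Involutive σ₁) (hc : Continuous σ₁)
    (h : InvolutionMap₀ σ₁ GrassOne.conj f₀ c) :
    EquivariantMap₀ SU2 (mk σ₁ f₀ SphereV.e0) c.complexToQuaternion :=
  ⟨⟨InvolutionMap₀.extensionFun h, InvolutionMap₀.continuous_extensionFun hσ hc h⟩,
    InvolutionMap₀.extensionFun_smul hσ h,
    (InvolutionMap₀.extensionFun_mk hσ h f₀).trans (congrArg _ h.2.2)⟩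

theorem InvolutionMap₀.continuous_extension [CompactSpace F] (hσ : Function.Involutive σ₁)
    (hc : Continuous σ₁) :
    Continuous (InvolutionMap₀.extension (f₀ := f₀) (c := c) hσ hc) :=
  Continuous.subtype_mk (ContinuousMap.continuous_of_continuous_uncurry _
    (InvolutionMap₀.continuous_uncurry_extensionFun hσ hc)) _

/-- Restriction to the slice is a homeomorphism of mapping spaces. -/
def restrictionHomeomorph [CompactSpace F] (hσ : Function.Involutive σ₁) (hc : Continuous σ₁) :
    EquivariantMap₀ SU2 (mk σ₁ f₀ SphereV.e0) c.complexToQuaternion ≃ₜ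
      InvolutionMap₀ σ₁ GrassOne.conj f₀ c where
  toFun := EquivariantMap₀.restriction
  invFun := InvolutionMap₀.extension hσ hc
  left_inv f := by
    refine Subtype.ext (ContinuousMap.ext fun t => ?_)
    obtain ⟨⟨x, p⟩, rfl⟩ := orbit_surjective t
    refine (InvolutionMap₀.extensionFun_orbit hσ _ _).trans ?_
    rw [EquivariantMap₀.complexToQuaternion_restriction, ← f.2.1, smul_mk]
    rfl
  right_inv h := by
    refine Subtype.ext (ContinuousMap.ext fun x => GrassOne.complexToQuaternion_injective ?_)
    rw [EquivariantMap₀.complexToQuaternion_restriction]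
    exact InvolutionMap₀.extensionFun_mk hσ h x
  continuous_toFun := EquivariantMap₀.continuous_restriction
  continuous_invFun := InvolutionMap₀.continuous_extension hσ hc

end Restriction

end

/-- `SU(2) ≅ Sp(1)` acts on `G₁(ℍ^∞)` by left multiplication of the coordinates. The canonical
homeomorphism is evaluation at the base point `e₀` of `S(v)`, followed by the identification of
`G₁(ℂ^∞)` with its image in `G₁(ℍ^∞)`. -/
theorem proposition3p3p14 (g : ℕ) (F : Type*) [TopologicalSpace F] (σ₁ : F → F)
    (hF : IsReflectedSurface g F σ₁) (f₀ : F) (hf₀ : σ₁ f₀ = f₀)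
    (b : GrassOne ℍ[ℝ]) (hb : ∀ p ∈ Pin2, p • b = b) :
    ∃ c : GrassOne ℂ, GrassOne.complexToQuaternion c = b ∧ GrassOne.conj c = c ∧
      ∃ Φ : EquivariantMap₀ SU2 (TwistedProduct.mk σ₁ f₀ SphereV.e0) b ≃ₜ
          InvolutionMap₀ σ₁ GrassOne.conj f₀ c,
        ∀ (f : EquivariantMap₀ SU2 (TwistedProduct.mk σ₁ f₀ SphereV.e0) b) (x : F),
          GrassOne.complexToQuaternion ((Φ f).1 x) = f.1 (TwistedProduct.mk σ₁ x SphereV.e0) := by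
  -- Invariance under `i` makes the base point complex; invariance under `j` makes it
  -- self-conjugate.
  obtain ⟨c, rfl⟩ := GrassOne.exists_complexToQuaternion_eq (hb _ SU2.I_mem_Pin2)
  have := hF.compactSpace
  refine ⟨c, rfl, GrassOne.complexToQuaternion_injective ?_,
    restrictionHomeomorph hF.involutive hF.continuous,
    EquivariantMap₀.complexToQuaternion_restriction⟩
  rw [← SU2.J_smul_complexToQuaternion]
  exact hb _ SU2.J_mem_Pin2
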